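/- Let $\mathbb{F}=\mathbb{F}_2$, and let $\mathbf{e}$ and $\mathbf{u}$ denote the all-zero and all-one words of $\mathbb{F}^n$. For $\pi\in S_n$ and $x\in\mathbb{F}^n$ write $\pi(x)=(x_{\pi^{-1}(1)},\dots,x_{\pi^{-1}(n)})$. A *propelinear code* of length $n$ is a subset $C\subseteq\mathbb{F}^n$ containing $\mathbf{e}$ together with a permutation $\pi_x\in S_n$ for every $x\in C$ such that, for all $x,y\in C$, $x+\pi_x(y)\in C$ and $\pi_x\pi_y=\pi_z$ with $z=x+\pi_x(y)$; then $C$ is a group under $x*y=x+\pi_x(y)$, with identity $\mathbf{e}$. It is a *Hadamard full propelinear code* if, in addition, $C$ consists of the rows of some $n\times n$ Hadamard matrix (a matrix $H$ with entries $\pm1$ and $HH^T=nI_n$; replace $1$ by $0$ and $-1$ by $1$) and the complements of these rows, $\pi_{\mathbf{e}}=\pi_{\mathbf{u}}=\mathrm{id}$, and $\pi_x$ has no fixed coordinate for every $x\in C\setminus\{\mathbf{e},\mathbf{u}\}$. For $t\ge 1$, an *$\mathrm{HFP}(2t,4_{\mathbf{u}})$-code of length $4t$* is a Hadamard full propelinear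 code $C$ of length $4t$ which, as a group, is the direct product $\langle a\rangle\times\langle b\rangle\cong C_{2t}\times C_4$ of cyclic groups with $a$ of order $2t$, $b$ of order $4$ and $b^2=\mathbf{u}$. **Proposition.** Let $C$ be an $\mathrm{HFP}(2t,4_{\mathbf{u}})$-code of length $4t$. If $t$ is a power of two, then $t\le 8$. -/

import Mathlib

/-- The action of a permutation of the coordinates on a binary word:
`π (x₁, …, xₙ) = (x_{π⁻¹ 1}, …, x_{π⁻¹ n})`. -/
def permuteWord {n : ℕ} (π : Equiv.Perm (Fin n)) (x : Fin n → ZMod 2) : Fin n → ZMod 2 :=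
  fun i => x (π⁻¹ i)

/-- A propelinear code of length `n`: a binary code `C` containing the all-zero word, together with
a coordinate permutation `π_x` for every codeword `x` such that, for all `x, y ∈ C`,
`x + π_x y ∈ C` and `π_x π_y = π_z` where `z = x + π_x y`. -/
structure PropelinearCode (n : ℕ) where
  carrier : Set (Fin n → ZMod 2)
  perm : carrier → Equiv.Perm (Fin n)
  zero_mem : (0 : Fin n → ZMod 2) ∈ carrier
  add_mem : ∀ x y : carrier, x.1 + permuteWord (perm x) y.1 ∈ carrier
  perm_mul : ∀ x y : carrier,
    perm x * perm y = perm ⟨x.1 + permuteWord (perm x) y.1, add_mem x y⟩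

namespace PropelinearCode

variable {n : ℕ} (C : PropelinearCode n)

/-- The operation `x * y = x + π_x y` on the codewords. -/
instance instMul : Mul C.carrier :=
  ⟨fun x y => ⟨x.1 + permuteWord (C.perm x) y.1, C.add_mem x y⟩⟩

/-- The neutral element is the all-zero word. -/
instance instOne : One C.carrier := ⟨⟨0, C.zero_mem⟩⟩

theorem coe_mul (x y : C.carrier) : (x * y).1 = x.1 + permuteWord (C.perm x) y.1 := rfl

theorem coe_one : (1 : C.carrier).1 = 0 := rfl

theorem map_mul (x y : C.carrier) : C.perm (x * y) = C.perm x * C.perm y :=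
  (C.perm_mul x y).symm

theorem one_mul' (x : C.carrier) : 1 * x = x := by
  have h : C.perm 1 = 1 := by
    have h1 : C.perm 1 * C.perm 1 = C.perm 1 := by
      rw [← C.map_mul]
      refine congrArg C.perm (Subtype.ext ?_)
      funext i
      simp [coe_mul, coe_one, permuteWord]
    exact mul_eq_left.mp h1
  apply Subtype.ext
  funext i
  simp [coe_mul, coe_one, permuteWord, h]

theorem mul_one' (x : C.carrier) : x * 1 = x := by
  apply Subtype.ext
  funext i
  simp [coe_mul, coe_one, permuteWord]

theorem mul_assoc' (x y z : C.carrier) : x * y * z = x * (y * z) := by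
  apply Subtype.ext
  funext i
  simp [coe_mul, map_mul, permuteWord, add_assoc]

theorem mul_left_injective' (x : C.carrier) : Function.Injective (fun y : C.carrier => x * y) := by
  intro y z h
  have h1 : (x * y).1 = (x * z).1 := congrArg Subtype.val h
  apply Subtype.ext
  funext i
  have h2 := congrFun h1 (C.perm x i)
  simpa [coe_mul, permuteWord] using h2

theorem exists_mul_eq_one (x : C.carrier) : ∃ y : C.carrier, x * y = 1 :=
  (Finite.injective_iff_surjective.mp (C.mul_left_injective' x)) 1

theorem exists_left_inv (x : C.carrier) : ∃ y : C.carrier, y * x = 1 := by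
  obtain ⟨y, hy⟩ := C.exists_mul_eq_one x
  refine ⟨y, C.mul_left_injective' x ?_⟩
  change x * (y * x) = x * 1
  rw [← C.mul_assoc', hy, C.one_mul', C.mul_one']

noncomputable instance instInv : Inv C.carrier := ⟨fun x => (C.exists_left_inv x).choose⟩

/-- The group of codewords under `x * y = x + π_x y`. -/
noncomputable instance instGroup : Group C.carrier :=
  Group.ofLeftAxioms C.mul_assoc' C.one_mul' fun x => (C.exists_left_inv x).choose_spec

end PropelinearCode

/-- The binary word of a `±1` row: `1` is replaced by `0` and `-1` by `1`. -/
def binaryRow {n : ℕ} (r : Fin n → ℤ) : Fin n → ZMod 2 :=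
  fun j => if r j = 1 then 0 else 1

/-- A binary Hadamard code of length `n`: the rows of an `n × n` Hadamard matrix with entries `±1`,
with `1` replaced by `0` and `-1` by `1`, together with the complements of these rows. -/
def IsHadamardCode {n : ℕ} (S : Set (Fin n → ZMod 2)) : Prop :=
  ∃ H : Matrix (Fin n) (Fin n) ℤ, H.IsHadamard ∧
    S = {x | ∃ i, x = binaryRow (H i) ∨ x = binaryRow (H i) + 1}

namespace PropelinearCode

/-- Hadamard full propelinear codes. Here `0` and `1` are the all-zero and the all-one word. -/
structure IsHFP {n : ℕ} (C : PropelinearCode n) : Prop where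
  hadamard : IsHadamardCode C.carrier
  perm_eq_one : ∀ x : C.carrier, x.1 = 0 ∨ x.1 = 1 → C.perm x = 1
  perm_no_fixed : ∀ x : C.carrier, x.1 ≠ 0 → x.1 ≠ 1 → ∀ i, C.perm x i ≠ i

/-- An `HFP(2t, 4_u)`-code of length `4t`: a Hadamard full propelinear code whose group is the
direct product `C_{2t} × C_4`, where the all-one word `u` is the square of a generator of `C_4`. -/
def IsHFPTwoFour {t : ℕ} (C : PropelinearCode (4 * t)) : Prop :=
  C.IsHFP ∧
    ∃ φ : C.carrier ≃* Multiplicative (ZMod (2 * t)) × Multiplicative (ZMod 4),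
      ∃ u : C.carrier, u.1 = 1 ∧ φ u = (1, Multiplicative.ofAdd 2)

end PropelinearCode

/-! Fix a coordinate. Its sign, as a function f on G = C_{2t} × C_4, has autocorrelation 8t at the
identity, -8t at u and 0 elsewhere (`PropelinearCode.IsHFP.autocorrelation`), because codewords
other than e and u are balanced and the orbit map of G hits every coordinate twice.

Let t = 2^s ≥ 16. The character a ↦ x, b ↦ x^(t/2) into ℤ[x]/(x^t + 1) sends u to x^t = -1, so the
sum S of f against it satisfies S * conj S = 8t + 8t = 16t. Here 2 is totally ramified with
self-conjugate prime x - 1, so 2^8 ∣ 16t forces 2^4 ∣ S (`two_pow_dvd_of_dvd_mul_conj`). But each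
coordinate of S in the basis 1, …, x^(t-1) is a signed sum of eight signs, hence smaller than 16. So
S = 0 (`sum_eq_zero_of_dvd`), contradicting S * conj S = 16t. -/

/-! ### Total ramification of 2 -/

section TotallyRamified

variable {R : Type*} [CommRing R]

/-- In a commutative ring with `x ^ 2 ^ s = -1`, the elements `(x - 1) ^ 2 ^ j` and
`x ^ 2 ^ j - 1` divide each other for `j ≤ s`. -/
theorem sub_one_pow_two_pow_dvd_dvd {s : ℕ} {x : R} (hx : x ^ 2 ^ s = -1) {j : ℕ} (hj : j ≤ s) :
    (x - 1) ^ 2 ^ j ∣ x ^ 2 ^ j - 1 ∧ x ^ 2 ^ j - 1 ∣ (x - 1) ^ 2 ^ j := by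
  induction j with
  | zero => simp
  | succ j ih =>
    obtain ⟨h1, h2⟩ := ih (by omega)
    obtain ⟨q, hq⟩ : ∃ q, s = j + 1 + q := ⟨s - (j + 1), by omega⟩
    set y := x ^ 2 ^ j with hy
    have hy2 : y ^ (2 * 2 ^ q) = -1 := by
      rw [hy, ← pow_mul, ← hx, hq]
      congr 1
      ring
    -- An odd power of y equals -y, so z - 1 ∣ z^odd - 1 at z = y and z = -y makes y - 1 and y + 1
    -- associates.
    have hodd : y ^ (2 * 2 ^ q + 1) = -y := by rw [pow_succ, hy2]; ring
    have h3 : y - 1 ∣ y + 1 := by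
      have := sub_one_dvd_pow_sub_one y (2 * 2 ^ q + 1)
      rw [hodd] at this
      rw [← dvd_neg]
      convert this using 1
      ring
    have h4 : y + 1 ∣ y - 1 := by
      have := sub_one_dvd_pow_sub_one (-y) (2 * 2 ^ q + 1)
      rw [Odd.neg_pow ⟨_, rfl⟩, hodd, neg_neg] at this
      rw [← neg_dvd]
      convert this using 1
      ring
    have e1 : (x - 1) ^ 2 ^ (j + 1) = (x - 1) ^ 2 ^ j * (x - 1) ^ 2 ^ j := by ring
    have e2 : x ^ 2 ^ (j + 1) - 1 = (y - 1) * (y + 1) := by rw [hy]; ring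
    rw [e1, e2]
    exact ⟨mul_dvd_mul h1 (h1.trans h3), mul_dvd_mul h2 (h4.trans h2)⟩

theorem sub_one_pow_dvd_two {s : ℕ} {x : R} (hx : x ^ 2 ^ s = -1) : (x - 1) ^ 2 ^ s ∣ 2 := by
  have := (sub_one_pow_two_pow_dvd_dvd hx le_rfl).1
  rw [hx, ← dvd_neg] at this
  convert this using 1
  ring

theorem two_dvd_sub_one_pow {s : ℕ} {x : R} (hx : x ^ 2 ^ s = -1) : 2 ∣ (x - 1) ^ 2 ^ s := by
  have := (sub_one_pow_two_pow_dvd_dvd hx le_rfl).2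
  rw [hx, ← neg_dvd] at this
  convert this using 1
  ring

/-- If a self-conjugate element `p` generates the kernel of a conjugation invariant map to `𝔽₂`,
then `p ^ (2 * m) ∣ X * conj X` implies `p ^ m ∣ X`. -/
theorem pow_dvd_of_pow_dvd_mul_conj {p : R} (hp : ∀ z, p * z = 0 → z = 0) (conj : R →+* R) {v : R}
    (hv : IsUnit v) (hconj : conj p = v * p) (ε : R →+* ZMod 2) (hεp : ε p = 0)
    (hε : ∀ z, ε z = 0 → p ∣ z) (hεc : ∀ z, ε (conj z) = ε z) (m : ℕ) :
    ∀ X : R, p ^ (2 * m) ∣ X * conj X → p ^ m ∣ X := by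
  induction m with
  | zero => simp
  | succ m ih =>
    rintro X ⟨W, hW⟩
    -- The residue of X * conj X is (ε X)^2, and 𝔽₂ is reduced.
    have hX : ε X = 0 := by
      have h := congrArg ε hW
      rw [map_mul, map_mul, map_pow, hεp, hεc, zero_pow (by omega), zero_mul] at h
      exact mul_self_eq_zero.mp h
    obtain ⟨Y, rfl⟩ := hε X hX
    rw [pow_succ']
    refine mul_dvd_mul_left p (ih Y ?_)
    -- X and conj X each contribute one factor p; both cancel since p is not a zero divisor.
    have h : p * (p * (v * (Y * conj Y) - p ^ (2 * m) * W)) = 0 := by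
      rw [map_mul, hconj] at hW
      linear_combination hW
    have h' := sub_eq_zero.mp (hp _ (hp _ h))
    rw [← hv.dvd_mul_left, h']
    exact dvd_mul_right _ _

end TotallyRamified

/-! ### Coordinates in ℤ[x]/(x^t + 1) -/

section NegacyclicRing

open Polynomial

theorem monic_X_pow_add_one {t : ℕ} (ht : t ≠ 0) : (X ^ t + 1 : ℤ[X]).Monic := by
  simpa using monic_X_pow_add_C (1 : ℤ) ht

theorem degree_X_pow_add_one {t : ℕ} (ht : t ≠ 0) : (X ^ t + 1 : ℤ[X]).degree = t := by
  simpa using degree_X_pow_add_C (Nat.pos_of_ne_zero ht) (1 : ℤ)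

theorem root_pow_eq_neg_one (t : ℕ) : AdjoinRoot.root (X ^ t + 1 : ℤ[X]) ^ t = -1 := by
  have h := AdjoinRoot.mk_self (f := (X ^ t + 1 : ℤ[X]))
  rw [map_add, map_pow, AdjoinRoot.mk_X, map_one] at h
  exact eq_neg_of_add_eq_zero_left h

theorem natCast_negacyclic_ne_zero {t : ℕ} (ht : t ≠ 0) {n : ℕ} (hn : n ≠ 0) :
    (n : AdjoinRoot (X ^ t + 1 : ℤ[X])) ≠ 0 := by
  have h := AdjoinRoot.of.injective_of_degree_ne_zero (f := (X ^ t + 1 : ℤ[X]))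
    (by rw [degree_X_pow_add_one ht]; exact_mod_cast ht)
  intro h0
  have h1 : AdjoinRoot.of (X ^ t + 1 : ℤ[X]) (n : ℤ) = AdjoinRoot.of (X ^ t + 1 : ℤ[X]) 0 := by
    rw [map_zero, ← h0]
    simp
  exact hn (by exact_mod_cast h h1)

theorem eq_zero_of_two_mul_eq_zero {t : ℕ} (ht : t ≠ 0) (z : AdjoinRoot (X ^ t + 1 : ℤ[X]))
    (hz : 2 * z = 0) : z = 0 := by
  induction z using AdjoinRoot.induction_on with
  | ih p =>
    have hm := monic_X_pow_add_one ht
    have h2 : AdjoinRoot.mk (X ^ t + 1 : ℤ[X]) ((2 : ℤ) • p) = 0 := by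
      rw [← hz, two_smul, map_add, two_mul]
    rw [AdjoinRoot.mk_eq_zero, ← modByMonic_eq_zero_iff_dvd hm] at h2 ⊢
    rw [smul_modByMonic] at h2
    exact (smul_eq_zero.mp h2).resolve_left two_ne_zero

/-- An element whose coordinates are smaller than `N` in absolute value and which is divisible by
`N` vanishes. -/
theorem sum_eq_zero_of_dvd {t : ℕ} (ht : t ≠ 0) (N : ℤ) (d : ℕ → ℤ) (hd : ∀ j, |d j| < N)
    (h : (N : AdjoinRoot (X ^ t + 1 : ℤ[X])) ∣
      ∑ j ∈ Finset.range t, (d j : AdjoinRoot (X ^ t + 1 : ℤ[X])) * AdjoinRoot.root _ ^ j) :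
    ∀ j < t, d j = 0 := by
  have hm := monic_X_pow_add_one ht
  set p : ℤ[X] := ∑ j ∈ Finset.range t, C (d j) * X ^ j with hp
  have hmk : AdjoinRoot.mk (X ^ t + 1 : ℤ[X]) p =
      ∑ j ∈ Finset.range t, (d j : AdjoinRoot (X ^ t + 1 : ℤ[X])) * AdjoinRoot.root _ ^ j := by
    rw [hp, map_sum]
    refine Finset.sum_congr rfl fun j _ => ?_
    rw [map_mul, map_pow, AdjoinRoot.mk_X, eq_intCast C, map_intCast]
  have hdeg : p.degree < (X ^ t + 1 : ℤ[X]).degree := by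
    rw [degree_X_pow_add_one ht]
    rw [hp, ← Fin.sum_univ_eq_sum_range fun j => C (d j) * X ^ j]
    exact degree_sum_fin_lt fun j : Fin t => d j
  obtain ⟨w, hw⟩ := h
  induction w using AdjoinRoot.induction_on with
  | ih q =>
    -- Since deg p < t, reduction modulo the monic x^t + 1 fixes p, so p is N times an integer
    -- polynomial.
    rw [← hmk, ← map_intCast (AdjoinRoot.mk (X ^ t + 1 : ℤ[X])), ← map_mul, AdjoinRoot.mk_eq_mk,
      ← modByMonic_eq_zero_iff_dvd hm, sub_modByMonic, (modByMonic_eq_self_iff hm).mpr hdeg,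
      ← eq_intCast C, ← smul_eq_C_mul, smul_modByMonic, sub_eq_zero] at hw
    intro j hj
    have hc : p.coeff j = d j := by
      simp [hp, coeff_X_pow, hj]
    refine Int.eq_zero_of_abs_lt_dvd ?_ (hd j)
    rw [← hc, hw, coeff_smul]
    exact dvd_mul_right _ _

end NegacyclicRing

/-! ### Residue map and conjugation -/

section NegacyclicRing

open Polynomial

/-- Reduction of `ℤ[x]/(x ^ t + 1)` modulo the prime `x - 1` above `2`. -/
noncomputable def negacyclicResidue (t : ℕ) : AdjoinRoot (X ^ t + 1 : ℤ[X]) →+* ZMod 2 :=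
  AdjoinRoot.lift (Int.castRingHom (ZMod 2)) 1 (by simp; decide)

theorem negacyclicResidue_root (t : ℕ) : negacyclicResidue t (AdjoinRoot.root _) = 1 :=
  AdjoinRoot.lift_root _

/-- Write p = (p - p(1)) + p(1): the first term is a multiple of x - 1, and p(1) is even while x - 1
∣ 2. -/
theorem root_sub_one_dvd_of_residue_eq_zero {t s : ℕ} (ht : t = 2 ^ s)
    (z : AdjoinRoot (X ^ t + 1 : ℤ[X])) (hz : negacyclicResidue t z = 0) :
    AdjoinRoot.root _ - 1 ∣ z := by
  have hx := root_pow_eq_neg_one t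
  induction z using AdjoinRoot.induction_on with
  | ih p =>
    have h1 : AdjoinRoot.root (X ^ t + 1 : ℤ[X]) - 1 ∣
        AdjoinRoot.mk (X ^ t + 1 : ℤ[X]) (p - C (p.eval 1)) := by
      rw [← AdjoinRoot.mk_X, ← map_one (AdjoinRoot.mk (X ^ t + 1 : ℤ[X])), ← map_sub]
      refine map_dvd _ ?_
      simpa using X_sub_C_dvd_sub_C_eval (a := (1 : ℤ)) (p := p)
    have h2 : AdjoinRoot.root (X ^ t + 1 : ℤ[X]) - 1 ∣
        AdjoinRoot.mk (X ^ t + 1 : ℤ[X]) (C (p.eval 1)) := by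
      have h3 : ((p.eval 1 : ℤ) : ZMod 2) = 0 := by
        rwa [negacyclicResidue, AdjoinRoot.lift_mk, eval₂_at_one, eq_intCast] at hz
      obtain ⟨m, hm⟩ := (ZMod.intCast_zmod_eq_zero_iff_dvd _ 2).mp h3
      rw [hm, eq_intCast C, map_intCast]
      push_cast
      refine Dvd.dvd.mul_right ((dvd_pow_self _ ?_).trans (sub_one_pow_dvd_two (s := s) ?_)) _
      · positivity
      · rw [← ht]; exact hx
    have := dvd_add h1 h2
    rwa [← map_add, sub_add_cancel] at this

/-- Complex conjugation `x ↦ x⁻¹` on `ℤ[x]/(x ^ t + 1)`. -/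
noncomputable def negacyclicConj {t : ℕ} (ht : t ≠ 0) :
    AdjoinRoot (X ^ t + 1 : ℤ[X]) →+* AdjoinRoot (X ^ t + 1 : ℤ[X]) :=
  AdjoinRoot.lift (AdjoinRoot.of _) (-AdjoinRoot.root _ ^ (t - 1)) <| by
    have hx := root_pow_eq_neg_one t
    have h : (AdjoinRoot.root (X ^ t + 1 : ℤ[X])) ^ t * (-AdjoinRoot.root _ ^ (t - 1)) ^ t = 1 := by
      rw [← mul_pow, mul_neg, ← pow_succ', Nat.sub_add_cancel (Nat.pos_of_ne_zero ht), hx, neg_neg,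
        one_pow]
    rw [hx] at h
    simp only [eval₂_add, eval₂_X_pow, eval₂_one]
    linear_combination -h

theorem root_mul_negacyclicConj {t : ℕ} (ht : t ≠ 0) :
    AdjoinRoot.root _ * negacyclicConj ht (AdjoinRoot.root _) = 1 := by
  rw [negacyclicConj, AdjoinRoot.lift_root, mul_neg, ← pow_succ',
    Nat.sub_add_cancel (Nat.pos_of_ne_zero ht), root_pow_eq_neg_one, neg_neg]

theorem negacyclicResidue_conj {t : ℕ} (ht : t ≠ 0) (z : AdjoinRoot (X ^ t + 1 : ℤ[X])) :
    negacyclicResidue t (negacyclicConj ht z) = negacyclicResidue t z := by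
  have h := congrArg (negacyclicResidue t) (root_mul_negacyclicConj ht)
  rw [map_mul, negacyclicResidue_root, one_mul, map_one] at h
  have : (negacyclicResidue t).comp (negacyclicConj ht) = negacyclicResidue t := by
    refine AdjoinRoot.ringHom_ext (RingHom.ext_int _ _) ?_
    rw [RingHom.comp_apply, h, negacyclicResidue_root]
  exact DFunLike.congr_fun this z

/-- If `2 ^ (2 * m)` divides `z * conj z` in `ℤ[x]/(x ^ 2 ^ s + 1)`, then `2 ^ m` divides `z`. -/
theorem two_pow_dvd_of_dvd_mul_conj {t s : ℕ} (ht : t = 2 ^ s) (ht0 : t ≠ 0) (m : ℕ)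
    (z : AdjoinRoot (X ^ t + 1 : ℤ[X])) (hz : 2 ^ (2 * m) ∣ z * negacyclicConj ht0 z) :
    2 ^ m ∣ z := by
  have hx : AdjoinRoot.root (X ^ t + 1 : ℤ[X]) ^ 2 ^ s = -1 := by
    rw [← ht]; exact root_pow_eq_neg_one t
  have h2 := sub_one_pow_dvd_two hx
  have hc := root_mul_negacyclicConj ht0
  set x := AdjoinRoot.root (X ^ t + 1 : ℤ[X])
  -- x - 1 is not a zero divisor because it divides 2, and conj (x - 1) = -x⁻¹ (x - 1).
  have key := pow_dvd_of_pow_dvd_mul_conj (p := x - 1) (fun w hw => by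
      obtain ⟨q, hq⟩ := (dvd_pow_self (x - 1) (by positivity)).trans h2
      refine eq_zero_of_two_mul_eq_zero ht0 w ?_
      rw [hq]
      linear_combination q * hw)
    (negacyclicConj ht0) (v := -negacyclicConj ht0 x) (IsUnit.of_mul_eq_one_right x hc).neg
    (by rw [map_sub, map_one]; linear_combination hc)
    (negacyclicResidue t) (by rw [map_sub, negacyclicResidue_root, map_one, sub_self])
    (root_sub_one_dvd_of_residue_eq_zero ht) (negacyclicResidue_conj ht0) (2 ^ s * m) z (by
      refine Dvd.dvd.trans ?_ hz
      rw [show 2 * (2 ^ s * m) = 2 ^ s * (2 * m) by ring, pow_mul]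
      exact pow_dvd_pow_of_dvd h2 _)
  refine Dvd.dvd.trans ?_ key
  rw [pow_mul]
  exact pow_dvd_pow_of_dvd (two_dvd_sub_one_pow hx) _

end NegacyclicRing

/-! ### The character sum -/

section Autocorrelation

open Polynomial

/-- The powers of an element with `x ^ N = 1`, indexed by `ZMod N`. -/
theorem pow_val_add {R : Type*} [Monoid R] {N : ℕ} [NeZero N] {x : R} (hx : x ^ N = 1)
    (i j : ZMod N) : x ^ (i + j).val = x ^ i.val * x ^ j.val := by
  rw [ZMod.val_add, ← pow_add]
  exact (pow_eq_pow_mod _ hx).symm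

theorem pow_val_natCast {R : Type*} [Monoid R] {N : ℕ} {x : R} (hx : x ^ N = 1)
    (n : ℕ) : x ^ (n : ZMod N).val = x ^ n := by
  rw [ZMod.val_natCast]
  exact (pow_eq_pow_mod _ hx).symm

theorem sum_zmod_eq_sum_range {M : Type*} [AddCommMonoid M] (N : ℕ) [NeZero N] (F : ZMod N → M) :
    ∑ j, F j = ∑ i ∈ Finset.range N, F i :=
  Finset.sum_bij' (fun j _ => j.val) (fun i _ => (i : ZMod N))
    (fun j _ => Finset.mem_range.mpr j.val_lt) (fun _ _ => Finset.mem_univ _)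
    (fun j _ => ZMod.natCast_zmod_val j)
    (fun i hi => ZMod.val_cast_of_lt (Finset.mem_range.mp hi)) (fun j _ => by simp)

/-- There is no `±1`-valued function on `C_{2t} × C_4`, `t = 2 ^ s ≥ 16`, with the autocorrelation
of a relative difference set: `8t` at `0`, `-8t` at `(0, 2)`, and `0` elsewhere. -/
theorem not_autocorrelation {t s : ℕ} (ht : t = 2 ^ s) (hs : 4 ≤ s)
    (f : ZMod (2 * t) × ZMod 4 → ℤ) (hf : ∀ h, |f h| ≤ 1)
    (hcorr : ∀ k : ZMod (2 * t) × ZMod 4, ∑ᶠ h, f (h + k) * f h =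
      if k = 0 then (8 * t : ℤ) else if k = (0, 2) then -(8 * t : ℤ) else 0) : False := by
  have ht0 : t ≠ 0 := by rw [ht]; positivity
  have : NeZero (2 * t) := ⟨by omega⟩
  simp only [finsum_eq_sum_of_fintype] at hcorr
  obtain ⟨M, hM⟩ : ∃ M, t = 2 * M := ⟨2 ^ (s - 1), by rw [ht, ← pow_succ']; congr 1; omega⟩
  have hxt := root_pow_eq_neg_one t
  have hcx := root_mul_negacyclicConj ht0
  set x := AdjoinRoot.root (X ^ t + 1 : ℤ[X])
  have hx : x ^ (2 * t) = 1 := by rw [two_mul, pow_add, hxt]; ring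
  -- The generator of C_4 goes to M = t/2: 4M = 2t vanishes, and twice the generator goes to t,
  -- where x^t = -1.
  let θ : ZMod 4 →+ ZMod (2 * t) := ZMod.lift 4 ⟨zmultiplesHom _ (M : ZMod (2 * t)), by
    have : ((4 * M : ℕ) : ZMod (2 * t)) = 0 :=
      (ZMod.natCast_eq_zero_iff _ _).mpr ⟨1, by omega⟩
    simpa using this⟩
  let ψ : ZMod (2 * t) × ZMod 4 →+ ZMod (2 * t) := (AddMonoidHom.id _).coprod θ
  let e : ZMod (2 * t) → AdjoinRoot (X ^ t + 1 : ℤ[X]) := fun j => x ^ j.val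
  have he : ∀ i j, e (i + j) = e i * e j := pow_val_add hx
  have he0 : e 0 = 1 := by simp [e]
  have hec : ∀ j, negacyclicConj ht0 (e j) = e (-j) := by
    intro j
    have h1 : e j * negacyclicConj ht0 (e j) = 1 := by
      simp only [e]
      rw [map_pow, ← mul_pow, hcx, one_pow]
    have h2 : e j * e (-j) = 1 := by rw [← he, add_neg_cancel, he0]
    linear_combination e (-j) * h1 - negacyclicConj ht0 (e j) * h2
  have hψ : e (ψ (0, 2)) = -1 := by
    have : ψ (0, 2) = (t : ZMod (2 * t)) := by
      have h2 : θ 2 = θ ((2 : ℤ) : ZMod 4) := by norm_num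
      simp only [ψ, AddMonoidHom.coprod_apply, map_zero, zero_add]
      have htM : (t : ZMod (2 * t)) = ((2 * M : ℕ) : ZMod (2 * t)) := congrArg _ hM
      rw [h2, ZMod.lift_coe, htM]
      simp
    rw [this]
    simp only [e]
    rw [pow_val_natCast hx, hxt]
  set S := ∑ h, (f h : AdjoinRoot (X ^ t + 1 : ℤ[X])) * e (ψ h) with hS
  have hSS : S * negacyclicConj ht0 S = ((16 * t : ℕ) : AdjoinRoot (X ^ t + 1 : ℤ[X])) := by
    have h02 : ((0, 2) : ZMod (2 * t) × ZMod 4) ≠ 0 := by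
      intro h
      have h2 : (2 : ZMod 4) = 0 := congrArg Prod.snd h
      exact absurd h2 (by decide)
    calc S * negacyclicConj ht0 S
        = ∑ h, ∑ g, (f g : AdjoinRoot (X ^ t + 1 : ℤ[X])) * f h * e (ψ (g - h)) := by
          rw [hS, map_sum, Finset.sum_mul_sum, Finset.sum_comm]
          refine Finset.sum_congr rfl fun h _ => Finset.sum_congr rfl fun g _ => ?_
          rw [map_mul, map_intCast, hec, sub_eq_add_neg, map_add, map_neg, he]
          ring
      _ = ∑ h, ∑ k, (f (h + k) : AdjoinRoot (X ^ t + 1 : ℤ[X])) * f h * e (ψ k) := by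
          refine Finset.sum_congr rfl fun h _ => ?_
          rw [← Equiv.sum_comp (Equiv.addLeft h)]
          simp
      _ = ∑ k, ((∑ h, f (h + k) * f h : ℤ) : AdjoinRoot (X ^ t + 1 : ℤ[X])) * e (ψ k) := by
          rw [Finset.sum_comm]
          refine Finset.sum_congr rfl fun k _ => ?_
          rw [Int.cast_sum, Finset.sum_mul]
          simp only [Int.cast_mul]
      _ = ∑ k, ((if k = 0 then (8 * t : AdjoinRoot (X ^ t + 1 : ℤ[X])) * e (ψ k) else 0) +
            if k = (0, 2) then -(8 * t : AdjoinRoot (X ^ t + 1 : ℤ[X])) * e (ψ k) else 0) := by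
          refine Finset.sum_congr rfl fun k _ => ?_
          rw [hcorr]
          by_cases h0 : k = 0
          · rw [h0, if_pos rfl, if_pos rfl, if_neg h02.symm]
            push_cast
            ring
          · by_cases h1 : k = (0, 2)
            · rw [if_neg h0, if_neg h0, if_pos h1, if_pos h1]
              push_cast
              ring
            · simp [h0, h1]
      _ = ((16 * t : ℕ) : AdjoinRoot (X ^ t + 1 : ℤ[X])) := by
          rw [Finset.sum_add_distrib, Finset.sum_ite_eq', Finset.sum_ite_eq',
            if_pos (Finset.mem_univ _), if_pos (Finset.mem_univ _), hψ, map_zero, he0]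
          push_cast
          ring
  -- 16t = 2^(4+s) is divisible by 2^8 because s ≥ 4.
  have hdvd : (2 : AdjoinRoot (X ^ t + 1 : ℤ[X])) ^ 4 ∣ S := by
    refine two_pow_dvd_of_dvd_mul_conj ht ht0 4 S ?_
    rw [hSS]
    obtain ⟨q, rfl⟩ := Nat.exists_eq_add_of_le hs
    refine ⟨2 ^ q, ?_⟩
    have : ((16 * t : ℕ) : AdjoinRoot (X ^ t + 1 : ℤ[X])) = ((16 * 2 ^ (4 + q) : ℕ) : _) := by
      congr 2
    rw [this]
    push_cast
    ring
  -- The sum of f over the four-element fibre of ψ above j.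
  let c : ZMod (2 * t) → ℤ := fun j => ∑ r, f (j - θ r, r)
  have hc : ∀ j, |c j| ≤ 4 := by
    intro j
    refine (Finset.abs_sum_le_sum_abs _ _).trans ((Finset.sum_le_sum fun r _ => hf _).trans ?_)
    simp
  -- Folding by x^(t+j) = -x^j; hence |d j| ≤ 4 + 4.
  let d : ℕ → ℤ := fun j => c (j : ZMod (2 * t)) - c ((t + j : ℕ) : ZMod (2 * t))
  have hd : ∀ j, |d j| < 16 := by
    intro j
    have h1 := hc (j : ZMod (2 * t))
    have h2 := hc ((t + j : ℕ) : ZMod (2 * t))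
    have h3 := abs_sub (c (j : ZMod (2 * t))) (c ((t + j : ℕ) : ZMod (2 * t)))
    show |c (j : ZMod (2 * t)) - c ((t + j : ℕ) : ZMod (2 * t))| < 16
    linarith
  have hSd : S = ∑ j ∈ Finset.range t, (d j : AdjoinRoot (X ^ t + 1 : ℤ[X])) * x ^ j := by
    calc S = ∑ j, (c j : AdjoinRoot (X ^ t + 1 : ℤ[X])) * e j := by
          rw [hS, Fintype.sum_prod_type_right]
          simp only [c, Int.cast_sum, Finset.sum_mul]
          conv_rhs => rw [Finset.sum_comm]
          refine Finset.sum_congr rfl fun r _ => ?_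
          refine Fintype.sum_equiv (Equiv.addRight (θ r)) _ _ fun j => ?_
          simp [ψ]
      _ = _ := by
          have hr : Finset.range (2 * t) = Finset.range (t + t) := by rw [two_mul]
          rw [sum_zmod_eq_sum_range, hr, Finset.sum_range_add, ← Finset.sum_add_distrib]
          refine Finset.sum_congr rfl fun j _ => ?_
          simp only [e, d]
          rw [pow_val_natCast hx, pow_val_natCast hx, pow_add, hxt]
          push_cast
          ring
  have hd0 := sum_eq_zero_of_dvd ht0 16 d hd (by
    rw [← hSd]
    convert hdvd using 1
    norm_num)
  have hS0 : S = 0 := by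
    rw [hSd]
    refine Finset.sum_eq_zero fun j hj => ?_
    rw [hd0 j (Finset.mem_range.mp hj), Int.cast_zero, zero_mul]
  rw [hS0, zero_mul] at hSS
  exact natCast_negacyclic_ne_zero ht0 (by omega) hSS.symm

end Autocorrelation

/-! ### Autocorrelation of a coordinate of the code -/

/-- The sign `(-1) ^ a` of a bit. -/
def bitSign (a : ZMod 2) : ℤ := if a = 0 then 1 else -1

theorem bitSign_add (a b : ZMod 2) : bitSign (a + b) = bitSign a * bitSign b := by
  revert a b; decide

theorem bitSign_mul_self (a : ZMod 2) : bitSign a * bitSign a = 1 := by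
  revert a; decide

theorem abs_bitSign (a : ZMod 2) : |bitSign a| = 1 := by
  revert a; decide

theorem bitSign_binaryRow {n : ℕ} {r : Fin n → ℤ} {j : Fin n} (h : r j = 1 ∨ r j = -1) :
    bitSign (binaryRow r j) = r j := by
  rcases h with h | h <;> simp [binaryRow, bitSign, h]

/-- Up to sign, the two words are rows of H; the hypotheses make these rows distinct, hence
orthogonal. -/
theorem IsHadamardCode.sum_bitSign_add {n : ℕ} {S : Set (Fin n → ZMod 2)} (hS : IsHadamardCode S)
    {x y : Fin n → ZMod 2} (hx : x ∈ S) (hy : y ∈ S) (h0 : x ≠ y) (h1 : x ≠ y + 1) :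
    ∑ j, bitSign (x j + y j) = 0 := by
  obtain ⟨H, hH, rfl⟩ := hS
  have hpm : ∀ i j, H i j = 1 ∨ H i j = -1 := fun i j => by
    have h := (hH.apply_mem i j).1
    rw [star_trivial] at h
    exact mul_self_eq_one_iff.mp h
  have hrow : ∀ z i, (z = binaryRow (H i) ∨ z = binaryRow (H i) + 1) →
      ∃ ε : ℤ, ∀ j, bitSign (z j) = ε * H i j := by
    rintro z i (rfl | rfl)
    · exact ⟨1, fun j => by rw [bitSign_binaryRow (hpm i j), one_mul]⟩
    · refine ⟨-1, fun j => ?_⟩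
      rw [Pi.add_apply, bitSign_add, bitSign_binaryRow (hpm i j), mul_comm]
      rfl
  obtain ⟨i, hi⟩ := hx
  obtain ⟨k, hk⟩ := hy
  have hik : i ≠ k := by
    rintro rfl
    have h11 : (1 : Fin n → ZMod 2) + 1 = 0 := funext fun _ => (by decide : (1 : ZMod 2) + 1 = 0)
    rcases hi with rfl | rfl <;> rcases hk with rfl | rfl
    · exact h0 rfl
    · exact h1 (by rw [add_assoc, h11, add_zero])
    · exact h1 rfl
    · exact h0 rfl
  obtain ⟨ε, hε⟩ := hrow x i hi
  obtain ⟨δ, hδ⟩ := hrow y k hk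
  have horth : ∑ j, H i j * H k j = 0 := by
    have h := congrFun (congrFun hH.mul_conjTranspose i) k
    simpa [Matrix.mul_apply, hik] using h
  calc ∑ j, bitSign (x j + y j) = ∑ j, ε * δ * (H i j * H k j) := by
        refine Finset.sum_congr rfl fun j _ => ?_
        rw [bitSign_add, hε, hδ]
        ring
    _ = 0 := by rw [← Finset.mul_sum, horth, mul_zero]

namespace PropelinearCode

variable {n : ℕ} {C : PropelinearCode n}

/-- The action of the group of codewords on the coordinates. -/
noncomputable def permHom (C : PropelinearCode n) : C.carrier →* Equiv.Perm (Fin n) :=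
  MonoidHom.mk' C.perm C.map_mul

/-- In a Hadamard full propelinear code with `2 n` words, every coordinate is hit exactly twice
by the orbit map of a coordinate. -/
theorem IsHFP.sum_perm_inv (hC : C.IsHFP) [Fintype C.carrier]
    (hcard : Fintype.card C.carrier = 2 * n)
    (i₀ : Fin n) (w : Fin n → ℤ) : ∑ g, w ((C.perm g)⁻¹ i₀) = 2 * ∑ i, w i := by
  classical
  -- If g and h agree at i₀, then h * g⁻¹ fixes i₀ and so is one of the two words 0 and 1.
  have hfib : ∀ i, (Finset.univ.filter fun g => (C.perm g)⁻¹ i₀ = i).card ≤ 2 := by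
    intro i
    by_cases hne : ∃ g, (C.perm g)⁻¹ i₀ = i
    · obtain ⟨g, hg⟩ := hne
      have hker : ∀ h : C.carrier, (C.perm h)⁻¹ i₀ = i → (h * g⁻¹).1 = 0 ∨ (h * g⁻¹).1 = 1 := by
        intro h hh
        by_contra! hcon
        refine hC.perm_no_fixed (h * g⁻¹) hcon.1 hcon.2 i₀ ?_
        have : C.perm (h * g⁻¹) = C.perm h * (C.perm g)⁻¹ := by
          change C.permHom (h * g⁻¹) = C.permHom h * (C.permHom g)⁻¹
          rw [_root_.map_mul, map_inv]
        rw [this, Equiv.Perm.mul_apply, hg, ← hh]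
        simp
      have hinj : Set.InjOn (fun h : C.carrier => (h * g⁻¹).1)
          (Finset.univ.filter fun g => (C.perm g)⁻¹ i₀ = i : Finset C.carrier) :=
        fun a _ b _ hab => mul_right_cancel (Subtype.ext hab)
      rw [← Finset.card_image_of_injOn hinj]
      refine (Finset.card_le_card (t := {0, 1}) fun z hz => ?_).trans Finset.card_le_two
      obtain ⟨h, hh, rfl⟩ := Finset.mem_image.mp hz
      simpa using hker h (Finset.mem_filter.mp hh).2
    · push Not at hne
      rw [Finset.filter_false_of_mem fun g _ => hne g]
      simp
  -- The n fibres have total size 2n, so the bound 2 is attained on each.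
  have htotal : ∑ i, (Finset.univ.filter fun g => (C.perm g)⁻¹ i₀ = i).card = ∑ _i : Fin n, 2 := by
    rw [← Finset.card_eq_sum_card_fiberwise fun _ _ => Finset.mem_univ _, Finset.card_univ, hcard]
    simp [mul_comm]
  have heq := (Finset.sum_eq_sum_iff_of_le fun i _ => hfib i).mp htotal
  rw [← Finset.sum_fiberwise Finset.univ (fun g => (C.perm g)⁻¹ i₀), Finset.mul_sum]
  refine Finset.sum_congr rfl fun i hi => ?_
  rw [Finset.sum_congr rfl fun g hg => by rw [(Finset.mem_filter.mp hg).2], Finset.sum_const,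
    heq i hi]
  simp

/-- The autocorrelation of the sign of a coordinate on the group of a Hadamard full propelinear
code. -/
theorem IsHFP.autocorrelation (hC : C.IsHFP) [Fintype C.carrier]
    (hcard : Fintype.card C.carrier = 2 * n) (i₀ : Fin n) (x : C.carrier) :
    ∑ g : C.carrier, bitSign ((g * x).1 i₀) * bitSign (g.1 i₀) =
      if x.1 = 0 then (2 * n : ℤ) else if x.1 = 1 then -(2 * n : ℤ) else 0 := by
  have h : ∀ g : C.carrier,
      bitSign ((g * x).1 i₀) * bitSign (g.1 i₀) = bitSign (x.1 ((C.perm g)⁻¹ i₀)) := by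
    intro g
    rw [coe_mul, Pi.add_apply, bitSign_add, permuteWord]
    linear_combination bitSign (x.1 ((C.perm g)⁻¹ i₀)) * bitSign_mul_self (g.1 i₀)
  rw [Finset.sum_congr rfl fun g _ => h g, hC.sum_perm_inv hcard i₀ fun i => bitSign (x.1 i)]
  split_ifs with h0 h1
  · simp [h0, bitSign]
  · simp [h1, bitSign]
  -- Orthogonality to the zero word says that x is balanced.
  · have := hC.hadamard.sum_bitSign_add x.2 C.zero_mem h0 (by rwa [zero_add])
    simp only [Pi.zero_apply, add_zero] at this
    rw [this, mul_zero]

end PropelinearCode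

/-! ### The bound on t -/

theorem mainTheorem11 (t : ℕ) (C : PropelinearCode (4 * t)) (hC : C.IsHFPTwoFour)
    (ht : ∃ s : ℕ, t = 2 ^ s) : t ≤ 8 := by
  obtain ⟨hH, φ, u, hu, hφu⟩ := hC
  obtain ⟨s, hs⟩ := ht
  by_contra! hlt
  have hs4 : 4 ≤ s := by
    by_contra! h
    have : 2 ^ s ≤ 2 ^ 3 := Nat.pow_le_pow_right two_pos (by omega)
    omega
  have : NeZero (2 * t) := ⟨by omega⟩
  have hfin : Fintype C.carrier := Fintype.ofFinite _
  let ι : ZMod (2 * t) × ZMod 4 ≃ C.carrier :=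
    (Equiv.prodCongr Multiplicative.ofAdd Multiplicative.ofAdd).trans φ.symm.toEquiv
  have hι : ∀ h k, ι (h + k) = ι h * ι k := fun h k => _root_.map_mul φ.symm
    (Multiplicative.ofAdd h.1, Multiplicative.ofAdd h.2)
    (Multiplicative.ofAdd k.1, Multiplicative.ofAdd k.2)
  have hι0 : ι 0 = 1 := map_one φ.symm
  have hιu : ι (0, 2) = u := (φ.symm_apply_eq.mpr hφu.symm)
  have hcard : Fintype.card C.carrier = 2 * (4 * t) := by
    rw [← Fintype.card_congr ι, Fintype.card_prod, ZMod.card, ZMod.card]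
    ring
  refine not_autocorrelation hs hs4 (fun h => bitSign ((ι h).1 ⟨0, by omega⟩))
    (fun h => (abs_bitSign _).le) fun k => ?_
  have h0 : (ι k).1 = 0 ↔ k = 0 := by
    rw [← ι.injective.eq_iff, hι0, Subtype.ext_iff, PropelinearCode.coe_one]
  have h1 : (ι k).1 = 1 ↔ k = (0, 2) := by
    rw [← ι.injective.eq_iff, hιu, Subtype.ext_iff, hu]
  have key := hH.autocorrelation hcard ⟨0, by omega⟩ (ι k)
  rw [← ι.sum_comp] at key
  rw [finsum_eq_sum_of_fintype]
  simp only [hι]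
  rw [key]
  simp only [h0, h1]
  push_cast
  ring_nf
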